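/- All graphs are finite, undirected, without loops and without multiple edges. A graph is cubic if every vertex has degree three, and claw-free if it has no induced subgraph isomorphic to $K_{1,3}$. \textbf{Theorem.} Let $G$ be a connected claw-free cubic graph. Then $G$ is good, that is, its edge set $E(G)$ can be partitioned into the edge sets of a spanning tree $T$ of $G$, a matching $M$ (possibly empty), and a nonempty $2$-regular subgraph $O$ of $G$ (a nonempty vertex-disjoint union of cycles). Thus Hoffmann-Ostenhof's conjecture holds for claw-free cubic graphs. -/

import Mathlib

namespace SimpleGraph

/-- A graph is claw-free if it has no induced subgraph isomorphic to `K_{1,3}`. -/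
def ClawFree {V : Type*} (G : SimpleGraph V) : Prop :=
  ¬ (completeBipartiteGraph (Fin 1) (Fin 3)).IsIndContained G

/-- A subgraph is 2-regular if each of its vertices has exactly two neighbours in it
(for a finite graph: it is a disjoint union of cycles). -/
def Subgraph.IsTwoRegular {V : Type*} {G : SimpleGraph V} (H : G.Subgraph) : Prop :=
  ∀ v ∈ H.verts, (H.neighborSet v).ncard = 2

/-- `T`, `M`, `O` form a good decomposition of `G`: a spanning tree, a matching (possibly
without edges) and a nonempty 2-regular subgraph whose edge sets partition the edges of `G`. -/
structure IsGoodDecomposition {V : Type*} (G : SimpleGraph V) (T M O : G.Subgraph) : Prop where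
  spanning : T.IsSpanning
  tree : T.coe.IsTree
  matching : M.IsMatching
  twoRegular : O.IsTwoRegular
  nonempty : O.verts.Nonempty
  cover : T.edgeSet ∪ M.edgeSet ∪ O.edgeSet = G.edgeSet
  disjoint_TM : Disjoint T.edgeSet M.edgeSet
  disjoint_TO : Disjoint T.edgeSet O.edgeSet
  disjoint_MO : Disjoint M.edgeSet O.edgeSet

/-- A graph is good if it has a good decomposition. -/
def IsGood {V : Type*} (G : SimpleGraph V) : Prop :=
  ∃ T M O : G.Subgraph, G.IsGoodDecomposition T M O

end SimpleGraph

/-! Let `L` be a maximal vertex set inducing a 2-regular graph whose edges can be deleted from `G`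
without disconnecting it; these edges form `O`. Each vertex of `L` keeps one edge, so the remaining
edges need a spanning tree `T` having degree at least two outside `L`: then what is left over is a
matching. If `L` were empty, `T` would have no leaf, so `O` is nonempty. To find `T`, prune cycle
edges twice: those in no triangle, giving `C`, then those whose removal keeps degree two outside
`L`, sparing edges of two triangles. A cycle surviving this would yield a triangle whose `T`-edges
leave it towards a single vertex. Such a triangle could be added to `L`
(`Removable.not_maximal_of_triangle`), so `T` is acyclic (`Removable.isAcyclic_of_maximal`). -/

namespace SimpleGraph

variable {V : Type*} {G T H : SimpleGraph V} {L : Set V}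

/-- The graph obtained from `G` by deleting the edges with both ends in `L`. -/
def withoutEdgesIn (G : SimpleGraph V) (L : Set V) : SimpleGraph V where
  Adj u v := G.Adj u v ∧ ¬ (u ∈ L ∧ v ∈ L)
  symm := ⟨fun _ _ h => ⟨h.1.symm, fun h' => h.2 h'.symm⟩⟩
  loopless := ⟨fun _ h => h.1.ne rfl⟩

/-- The subgraph induced by `L` is 2-regular, and deleting its edges does not disconnect `G`. -/
structure Removable (G : SimpleGraph V) (L : Set V) : Prop where
  twoRegular : ∀ v ∈ L, ∃ a b, a ≠ b ∧ ∀ x, G.Adj v x ∧ x ∈ L ↔ x = a ∨ x = b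
  connected : (G.withoutEdgesIn L).Connected

/-- `u v` is an edge of a triangle. -/
def InTriangle (G : SimpleGraph V) (u v : V) : Prop :=
  G.Adj u v ∧ ∃ w, G.Adj u w ∧ G.Adj v w

/-- `u v` is an edge of two triangles. -/
def InTwoTriangles (G : SimpleGraph V) (u v : V) : Prop :=
  G.Adj u v ∧ ∃ w w', w ≠ w' ∧ (G.Adj u w ∧ G.Adj v w) ∧ G.Adj u w' ∧ G.Adj v w'

/-- Two neighbours of a vertex can be completed by a third one to the whole neighbourhood. -/
def HasThirdNeighbors (G : SimpleGraph V) : Prop :=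
  ∀ v a b, G.Adj v a → G.Adj v b → a ≠ b →
    ∃ c, c ≠ a ∧ c ≠ b ∧ G.Adj v c ∧ ∀ x, G.Adj v x → x = a ∨ x = b ∨ x = c

/-! ### Local structure of claw-free cubic graphs -/

theorem IsRegularOfDegree.hasThirdNeighbors [G.LocallyFinite] (h : G.IsRegularOfDegree 3) :
    G.HasThirdNeighbors := by
  classical
  intro v a b ha hb hab
  obtain ⟨x, y, z, hxy, hxz, hyz, hs⟩ := Finset.card_eq_three.1 (h v)
  have key : ∀ t, G.Adj v t ↔ t = x ∨ t = y ∨ t = z := fun t => by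
    rw [← mem_neighborFinset, hs]; simp
  have hx := (key x).2 (by simp)
  have hy := (key y).2 (by simp)
  have hz := (key z).2 (by simp)
  grind

theorem ClawFree.exists_triangle [G.LocallyFinite] (h : G.ClawFree)
    (h3 : G.IsRegularOfDegree 3) (v : V) : ∃ a b, G.Adj v a ∧ G.Adj v b ∧ G.Adj a b := by
  classical
  obtain ⟨x, y, z, hxy, hxz, hyz, hs⟩ := Finset.card_eq_three.1 (h3 v)
  have key : ∀ t, G.Adj v t ↔ t = x ∨ t = y ∨ t = z := fun t => by
    rw [← mem_neighborFinset, hs]; simp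
  by_contra! hno
  have hx := (key x).2 (by simp)
  have hy := (key y).2 (by simp)
  have hz := (key z).2 (by simp)
  have nxy := hno x y hx hy
  have nxz := hno x z hx hz
  have nyz := hno y z hy hz
  let g : Fin 3 → V := ![x, y, z]
  have hg : Function.Injective g := by
    intro i j hij
    fin_cases i <;> fin_cases j <;> simp_all [g]
  have hvg : ∀ i, G.Adj v (g i) := by
    intro i; fin_cases i <;> simpa [g]
  have hgg : ∀ i j, ¬ G.Adj (g i) (g j) := by
    intro i j
    fin_cases i <;> fin_cases j <;> simp [g, nxy, nxz, nyz, G.adj_comm y x, G.adj_comm z x, G.adj_comm z y]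
  refine h ⟨⟨⟨Sum.elim (fun _ => v) g, ?_⟩, ?_⟩⟩
  · rintro (i | i) (j | j) hij
    · rw [Subsingleton.elim i j]
    · exact absurd hij (hvg j).ne
    · exact absurd hij (hvg i).ne'
    · exact congrArg _ (hg hij)
  · rintro (i | i) (j | j)
    · change G.Adj v v ↔ _
      simp
    · change G.Adj v (g j) ↔ _
      simpa using hvg j
    · change G.Adj (g i) v ↔ _
      simpa using (hvg i).symm
    · change G.Adj (g i) (g j) ↔ _
      simpa using hgg i j

/-! ### Adding a triangle to a removable set -/

theorem Connected.forall_of_adj_closed (hT : T.Connected) {P : V → Prop} {u : V} (hu : P u)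
    (h : ∀ x y, T.Adj x y → P x → P y) (x : V) : P x := by
  obtain ⟨p⟩ := hT.preconnected u x
  induction p with
  | nil => exact hu
  | cons hadj _ ih => exact ih (h _ _ hadj hu)

theorem Reachable.of_map {f : V → V} (hf : ∀ u v, T.Adj u v → H.Reachable (f u) (f v)) {u v : V}
    (h : T.Reachable u v) : H.Reachable (f u) (f v) := by
  obtain ⟨p⟩ := h
  induction p with
  | nil => rfl
  | cons hadj _ ih => exact (hf _ _ hadj).trans ih

/-- If all edges of `T` leaving a triangle outside `L` go to the same vertex, then the triangle
can be added to `L`. -/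
theorem Removable.not_maximal_of_triangle (h3 : G.HasThirdNeighbors) (hL : Maximal G.Removable L)
    (hT : T.Connected) (hTG : T ≤ G.withoutEdgesIn L) {u v w c : V}
    (huv : G.Adj u v) (huw : G.Adj u w) (hvw : G.Adj v w) (hu : u ∉ L) (hv : v ∉ L) (hw : w ∉ L)
    (hcu : c ≠ u) (hcv : c ≠ v) (hcw : c ≠ w)
    (hout : ∀ p q, T.Adj p q → p = u ∨ p = v ∨ p = w → q = u ∨ q = v ∨ q = w ∨ q = c) :
    False := by
  classical
  obtain ⟨D, hD⟩ : ∃ D : Set V, ∀ x, x ∈ D ↔ x = u ∨ x = v ∨ x = w := ⟨{u, v, w}, by simp⟩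
  have hDL : ∀ x ∈ D, x ∉ L := by grind
  have hcD : c ∉ D := by grind
  have hout' : ∀ p q, T.Adj p q → p ∈ D → q ∉ D → q = c := by grind
  have hnb : ∀ p ∈ D, ∃ a b s, a ∈ D ∧ b ∈ D ∧ a ≠ b ∧ s ∉ D ∧ G.Adj p a ∧ G.Adj p b ∧ G.Adj p s ∧
      ∀ x, G.Adj p x → x = a ∨ x = b ∨ x = s := by
    intro p hp
    have aux : ∀ a b, a ∈ D → b ∈ D → G.Adj p a → G.Adj p b → a ≠ b →
        (∀ x ∈ D, x = p ∨ x = a ∨ x = b) → ∃ a b s, a ∈ D ∧ b ∈ D ∧ a ≠ b ∧ s ∉ D ∧ G.Adj p a ∧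
        G.Adj p b ∧ G.Adj p s ∧ ∀ x, G.Adj p x → x = a ∨ x = b ∨ x = s := by
      intro a b ha hb hpa hpb hab hx
      obtain ⟨s, hsa, hsb, hps, hall⟩ := h3 p a b hpa hpb hab
      refine ⟨a, b, s, ha, hb, hab, fun hs => ?_, hpa, hpb, hps, hall⟩
      rcases hx s hs with h | h | h
      · exact hps.ne h.symm
      · exact hsa h
      · exact hsb h
    rcases (hD p).1 hp with rfl | rfl | rfl
    · exact aux v w (by grind) (by grind) huv huw hvw.ne (by grind)
    · exact aux u w (by grind) (by grind) huv.symm hvw huw.ne (by grind)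
    · exact aux u v (by grind) (by grind) huw.symm hvw.symm huv.ne (by grind)
  have hsL : ∀ p ∈ D, ∀ s ∉ D, G.Adj p s → s ∉ L := by
    intro p hp s hs hps hsL
    obtain ⟨a, b, hab, hx⟩ := hL.prop.twoRegular s hsL
    obtain ⟨hsa, haL⟩ := (hx a).2 (Or.inl rfl)
    obtain ⟨hsb, hbL⟩ := (hx b).2 (Or.inr rfl)
    obtain ⟨t, hta, htb, hst, hall⟩ := h3 s a b hsa hsb hab
    have hpL := hDL p hp
    -- Two of the three edges at `s` lie inside `L`, so `s` is a leaf of `T` hanging on `p`.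
    have hnb1 : ∀ x, T.Adj s x → x = p := by
      intro x hsx
      have := hTG hsx
      have h1 := hall x this.1
      have h2 := hall p hps.symm
      have h3 : x ∉ L := fun h => this.2 ⟨hsL, h⟩
      grind
    have : Nontrivial V := ⟨p, s, hps.ne⟩
    obtain ⟨y, hy⟩ := hT.preconnected.exists_adj_of_nontrivial s
    have hyp := hnb1 y hy
    subst hyp
    have hsc := hout' y s hy.symm hp hs
    subst hsc
    -- The only exit from the triangle is now the leaf `s`, so `T` would have no further vertex, yet
    -- `s` has a neighbour in `L`.
    have hall' := hT.forall_of_adj_closed (P := fun x => x ∈ D ∨ x = s) (Or.inr rfl) (by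
      rintro x z hxz (hxD | rfl)
      · by_cases hz : z ∈ D
        · exact Or.inl hz
        · exact Or.inr (hout' x z hxz hxD hz)
      · exact Or.inl (hnb1 z hxz ▸ hp))
    rcases hall' a with h | h
    · exact hDL a h haL
    · exact hsa.ne h.symm
  have hrem : G.Removable (L ∪ D) := by
    refine ⟨?_, ?_⟩
    · rintro p (hp | hp)
      · obtain ⟨a, b, hab, hx⟩ := hL.prop.twoRegular p hp
        refine ⟨a, b, hab, fun x => ?_⟩
        rw [← hx x]
        refine ⟨fun ⟨h, h'⟩ => ⟨h, h'.resolve_right fun hxD => ?_⟩, fun ⟨h, h'⟩ => ⟨h, Or.inl h'⟩⟩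
        exact hsL x hxD p (fun h => hDL p h hp) h.symm hp
      · obtain ⟨a, b, s, ha, hb, hab, hs, hpa, hpb, hps, hall⟩ := hnb p hp
        refine ⟨a, b, hab, fun x => ⟨fun ⟨h, h'⟩ => ?_, ?_⟩⟩
        · have := hsL p hp s hs hps
          rcases hall x h with h1 | h1 | h1
          · exact Or.inl h1
          · exact Or.inr h1
          · subst h1; rcases h' with h' | h' <;> contradiction
        · rintro (rfl | rfl)
          · exact ⟨hpa, Or.inr ha⟩
          · exact ⟨hpb, Or.inr hb⟩
    -- Contracting the triangle to `c` keeps `T` connected; each triangle vertex is then reattached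
    -- by its third edge, which survives by `hsL`.
    · let f : V → V := fun x => if x ∈ D then c else x
      have hfD : ∀ x ∈ D, f x = c := fun x hx => if_pos hx
      have hfn : ∀ x ∉ D, f x = x := fun x hx => if_neg hx
      have hf : ∀ x y, T.Adj x y → (G.withoutEdgesIn (L ∪ D)).Reachable (f x) (f y) := by
        intro x y hxy
        by_cases hx : x ∈ D <;> by_cases hy : y ∈ D
        · rw [hfD x hx, hfD y hy]
        · rw [hfD x hx, hfn y hy, hout' x y hxy hx hy]
        · rw [hfn x hx, hfD y hy, hout' y x hxy.symm hy hx]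
        · rw [hfn x hx, hfn y hy]
          refine Adj.reachable ⟨(hTG hxy).1, ?_⟩
          rintro ⟨h1 | h1, h2 | h2⟩
          · exact (hTG hxy).2 ⟨h1, h2⟩
          all_goals contradiction
      have hvf : ∀ x, (G.withoutEdgesIn (L ∪ D)).Reachable x (f x) := by
        intro x
        by_cases hx : x ∈ D
        · obtain ⟨a, b, s, -, -, -, hs, -, -, hps, -⟩ := hnb x hx
          have hsL' := hsL x hx s hs hps
          have hadj : (G.withoutEdgesIn (L ∪ D)).Adj x s :=
            ⟨hps, fun h => h.2.elim hsL' hs⟩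
          have := Reachable.of_map hf (hT.preconnected s c)
          rw [hfn s hs, hfn c hcD] at this
          rw [hfD x hx]
          exact hadj.reachable.trans this
        · rw [hfn x hx]
      have : Nonempty V := ⟨u⟩
      exact ⟨fun x y => (hvf x).trans ((Reachable.of_map hf (hT.preconnected x y)).trans (hvf y).symm)⟩
  exact hu (hL.le_of_ge hrem Set.subset_union_left (Or.inr ((hD u).2 (Or.inl rfl))))

/-! ### Edges on cycles and acyclicity -/

theorem exists_not_isBridge_ne {u v : V} (huv : T.Adj u v) (hb : ¬ T.IsBridge s(u, v)) :
    ∃ w, w ≠ v ∧ T.Adj u w ∧ ¬ T.IsBridge s(u, w) := by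
  rw [isBridge_iff_forall_cycle_notMem huv] at hb
  push Not at hb
  obtain ⟨x, p, hp, he⟩ := hb
  have h2 := hp.ncard_neighborSet_toSubgraph_eq_two (p.fst_mem_support_of_mem_edges he)
  obtain ⟨w, hw, hwv⟩ := Set.exists_ne_of_one_lt_ncard (h2.symm ▸ one_lt_two) v
  have hw' : s(u, w) ∈ p.edges := by
    rw [← Walk.mem_edges_toSubgraph]; exact hw
  exact ⟨w, hwv, p.adj_of_mem_edges hw', fun h => h.notMem_edges_of_isCycle hp hw'⟩

theorem not_isBridge_of_common_neighbor {u v w : V} (huv : T.Adj u v) (huw : T.Adj u w) :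
    ¬ T.IsBridge s(v, w) := by
  rw [isBridge_iff, not_not]
  have h1 : (T.deleteEdges {s(v, w)}).Adj v u := by
    simp [deleteEdges_adj, huv.symm, huw.ne, huv.ne]
  have h2 : (T.deleteEdges {s(v, w)}).Adj u w := by
    simp [deleteEdges_adj, huw, huw.ne, huv.ne]
  exact h1.reachable.trans h2.reachable

/-- A vertex of `L` has only one neighbour outside `L`, hence degree at most one in `T`, too little
to lie on a cycle. -/
theorem notMem_of_not_isBridge (h3 : G.HasThirdNeighbors)
    (hL : ∀ v ∈ L, ∃ a b, a ≠ b ∧ ∀ x, G.Adj v x ∧ x ∈ L ↔ x = a ∨ x = b)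
    (hTG : T ≤ G.withoutEdgesIn L) {u v : V} (huv : T.Adj u v) (hb : ¬ T.IsBridge s(u, v)) :
    u ∉ L := by
  intro hu
  obtain ⟨w, hwv, huw, -⟩ := exists_not_isBridge_ne huv hb
  obtain ⟨a, b, hab, hx⟩ := hL u hu
  obtain ⟨hua, haL⟩ := (hx a).2 (Or.inl rfl)
  obtain ⟨hub, hbL⟩ := (hx b).2 (Or.inr rfl)
  obtain ⟨c, -, -, -, hall⟩ := h3 u a b hua hub hab
  have hv : v ∉ L := fun h => (hTG huv).2 ⟨hu, h⟩
  have hw : w ∉ L := fun h => (hTG huw).2 ⟨hu, h⟩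
  have h1 := hall v (hTG huv).1
  have h2 := hall w (hTG huw).1
  grind

/-- The main structural step: a connected spanning subgraph avoiding the edges inside a maximal
removable set is acyclic as soon as its cycles consist of edges of triangles, it contains the
edges of two triangles, and no other edge of a cycle has two ends of degree three. -/
theorem Removable.isAcyclic_of_maximal (h3 : G.HasThirdNeighbors) (hL : Maximal G.Removable L)
    (hT : T.Connected) (hTG : T ≤ G.withoutEdgesIn L)
    (hdbl : ∀ u v, G.InTwoTriangles u v → u ∉ L → T.Adj u v)
    (htri : ∀ u v, T.Adj u v → ¬ T.IsBridge s(u, v) → G.InTriangle u v)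
    (hmin : ∀ u v, T.Adj u v → ¬ T.IsBridge s(u, v) → ¬ G.InTwoTriangles u v →
      ∃ x, (x = u ∨ x = v) ∧ ∀ a b c, T.Adj x a → T.Adj x b → T.Adj x c → a = b ∨ a = c ∨ b = c) :
    T.IsAcyclic := by
  have hG : ∀ {x y}, T.Adj x y → G.Adj x y := fun h => (hTG h).1
  have hS : ∀ u v, T.Adj u v → ¬ T.IsBridge s(u, v) → u ∉ L := fun u v h hb =>
    notMem_of_not_isBridge h3 hL.prop.twoRegular hTG h hb
  have hsymm : ∀ u v, ¬ T.IsBridge s(u, v) → ¬ T.IsBridge s(v, u) := fun u v h => by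
    rwa [Sym2.eq_swap]
  have key : ∀ u v w c, G.Adj u v → G.Adj u w → G.Adj v w → u ∉ L → v ∉ L → w ∉ L →
      c ≠ u → c ≠ v → c ≠ w →
      (∀ p q, T.Adj p q → p = u ∨ p = v ∨ p = w → q = u ∨ q = v ∨ q = w ∨ q = c) → False :=
    fun u v w c a1 a2 a3 a4 a5 a6 a7 a8 a9 a10 =>
      Removable.not_maximal_of_triangle h3 hL hT hTG a1 a2 a3 a4 a5 a6 a7 a8 a9 a10
  -- Two edges of two triangles each at the same vertex force a complete graph.
  have hK4 : ∀ u v w, T.Adj u v → ¬ T.IsBridge s(u, v) → T.Adj u w → ¬ T.IsBridge s(u, w) →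
      v ≠ w → G.InTwoTriangles u v → G.InTwoTriangles u w → False := by
    intro u v w huv hb huw hb' hvw hd hd'
    obtain ⟨z, hzv, hzw, huz, hall⟩ := h3 u v w (hG huv) (hG huw) hvw
    have a1 : G.Adj v w ∧ G.Adj v z := by
      obtain ⟨-, x, y, hxy, ⟨h1, h2⟩, h3, h4⟩ := hd
      have := hall x h1; have := hall y h3; have := h2.ne; have := h4.ne
      grind
    have a2 : G.Adj w z := by
      obtain ⟨-, x, y, hxy, ⟨h1, h2⟩, h3, h4⟩ := hd'
      have := hall x h1; have := hall y h3; have := h2.ne; have := h4.ne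
      grind
    obtain ⟨v', _, _, _, hv⟩ := h3 v u w (hG huv).symm a1.1 (hG huw).ne
    obtain ⟨w', _, _, _, hw⟩ := h3 w u v (hG huw).symm a1.1.symm (hG huv).ne
    have hvz := hv z a1.2
    have hwz := hw z a2
    have := huz.ne
    refine key u v w z (hG huv) (hG huw) a1.1 (hS _ _ huv hb) (hS _ _ huv.symm (hsymm _ _ hb))
      (hS _ _ huw.symm (hsymm _ _ hb')) huz.ne' hzv hzw ?_
    rintro p q hpq (rfl | rfl | rfl)
    · have := hall q (hG hpq); grind
    · have := hv q (hG hpq); grind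
    · have := hw q (hG hpq); grind
  rw [isAcyclic_iff_forall_adj_isBridge]
  by_contra! hcyc
  obtain ⟨u, v, huv, hb, hnd, hdeg⟩ : ∃ u v, T.Adj u v ∧ ¬ T.IsBridge s(u, v) ∧
      ¬ G.InTwoTriangles u v ∧
      ∀ a b c, T.Adj u a → T.Adj u b → T.Adj u c → a = b ∨ a = c ∨ b = c := by
    obtain ⟨u, v, huv, hb⟩ := hcyc
    obtain ⟨w, hwv, huw, hb'⟩ := exists_not_isBridge_ne huv hb
    obtain ⟨v, huv, hb, hnd⟩ : ∃ v, T.Adj u v ∧ ¬ T.IsBridge s(u, v) ∧ ¬ G.InTwoTriangles u v := by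
      by_cases hd : G.InTwoTriangles u v
      · exact ⟨w, huw, hb', fun hd' => hK4 u v w huv hb huw hb' hwv.symm hd hd'⟩
      · exact ⟨v, huv, hb, hd⟩
    obtain ⟨x, rfl | rfl, hx⟩ := hmin u v huv hb hnd
    · exact ⟨x, v, huv, hb, hnd, hx⟩
    · refine ⟨x, u, huv.symm, hsymm _ _ hb, ?_, hx⟩
      rintro ⟨h, a, b, hab, h1, h2⟩
      exact hnd ⟨h.symm, a, b, hab, h1.symm, h2.symm⟩
  obtain ⟨w, hwv, huw, hb'⟩ := exists_not_isBridge_ne huv hb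
  have hu := hS _ _ huv hb
  have hv := hS _ _ huv.symm (hsymm _ _ hb)
  have hw := hS _ _ huw.symm (hsymm _ _ hb')
  obtain ⟨z, hzv, hzw, huz, hall⟩ := h3 u v w (hG huv) (hG huw) hwv.symm
  have huz' : ¬ T.Adj u z := fun h => by
    have := hdeg v w z huv huw h; grind
  -- Otherwise the triangles on `u v` and `u w` both contain `z`, and `u z`, lying in both, would
  -- belong to `T`.
  have hvw : G.Adj v w := by
    by_contra hvw
    have a1 : G.Adj v z := by
      obtain ⟨-, x, h1, h2⟩ := htri u v huv hb
      have := hall x h1; have := h2.ne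
      grind
    have a2 : G.Adj w z := by
      obtain ⟨-, x, h1, h2⟩ := htri u w huw hb'
      have := hall x h1; have := h2.ne; have := G.adj_comm v w
      grind
    exact huz' (hdbl u z ⟨huz, v, w, hwv.symm, ⟨hG huv, a1.symm⟩, hG huw, a2.symm⟩ hu)
  have hvz : ¬ G.Adj v z := fun h => hnd ⟨hG huv, w, z, hzw.symm, ⟨hG huw, hvw⟩, huz, h⟩
  obtain ⟨v', hv'u, hv'w, hvv', hallv⟩ := h3 v u w (hG huv).symm hvw (hG huw).ne
  obtain ⟨w', hw'u, hw'v, hww', hallw⟩ := h3 w u v (hG huw).symm hvw.symm (hG huv).ne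
  have hnu : ∀ q, T.Adj u q → q = v ∨ q = w := fun q hq => by
    rcases hall q (hG hq) with h | h | h
    · exact Or.inl h
    · exact Or.inr h
    · exact absurd (h ▸ hq) huz'
  -- If this edge is missing from `T`, then `w'` is the only exit from the triangle.
  have hTv : T.Adj v v' := by
    by_contra hn
    refine key u v w w' (hG huv) (hG huw) hvw hu hv hw hw'u hw'v hww'.ne' ?_
    rintro p q hpq (rfl | rfl | rfl)
    · have := hnu q hpq; grind
    · have := hallv q (hG hpq); grind
    · have := hallw q (hG hpq); grind
  have hTw : T.Adj w w' := by
    by_contra hn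
    refine key u v w v' (hG huv) (hG huw) hvw hu hv hw hv'u hvv'.ne' hv'w ?_
    rintro p q hpq (rfl | rfl | rfl)
    · have := hnu q hpq; grind
    · have := hallv q (hG hpq); grind
    · have := hallw q (hG hpq); grind
  have hne : v' ≠ w' := by
    rintro rfl
    refine key u v w v' (hG huv) (hG huw) hvw hu hv hw hv'u hvv'.ne' hv'w ?_
    rintro p q hpq (rfl | rfl | rfl)
    · have := hnu q hpq; grind
    · have := hallv q (hG hpq); grind
    · have := hallw q (hG hpq); grind
  by_cases hTvw : T.Adj v w
  · have hbvw := not_isBridge_of_common_neighbor huv huw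
    have hnd' : ¬ G.InTwoTriangles v w := by
      rintro ⟨-, x, y, hxy, ⟨h1, h2⟩, h3, h4⟩
      have := hallv x h1; have := hallv y h3; have := hallw x h2; have := hallw y h4
      have := h1.ne; have := h2.ne; have := h3.ne; have := h4.ne
      grind
    -- Both `v` and `w` have degree three in `T`, so `v w` should have been pruned.
    obtain ⟨x, rfl | rfl, hx⟩ := hmin v w hTvw hbvw hnd'
    · have := hx u w v' huv.symm hTvw hTv
      have := huw.ne
      grind
    · have := hx u v w' huw.symm hTvw.symm hTw
      have := huv.ne
      grind
  -- The cycle through `u v` must continue along `v v'`, which lies in no triangle.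
  · have hb1 : ¬ T.IsBridge s(v, v') := by
      obtain ⟨x, hx, hvx, hbx⟩ := exists_not_isBridge_ne huv.symm (hsymm _ _ hb)
      rcases hallv x (hG hvx) with h | h | h
      · exact absurd h hx
      · exact absurd (h ▸ hvx) hTvw
      · exact h ▸ hbx
    obtain ⟨-, x, h1, h2⟩ := htri v v' hTv hb1
    rcases hallv x h1 with rfl | rfl | rfl
    · rcases hall v' h2.symm with h | h | h
      · exact hvv'.ne h.symm
      · exact hv'w h
      · exact hvz (h ▸ hvv')
    · rcases hallw v' h2.symm with h | h | h
      · exact hv'u h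
      · exact hvv'.ne h.symm
      · exact hne h
    · exact h2.ne rfl

/-! ### Assembling the decomposition -/

theorem IsGood.of_isTree [Finite V] (h3 : G.HasThirdNeighbors)
    (hL : ∀ v ∈ L, ∃ a b, a ≠ b ∧ ∀ x, G.Adj v x ∧ x ∈ L ↔ x = a ∨ x = b)
    (hTG : T ≤ G.withoutEdgesIn L) (hT : T.IsTree)
    (hdeg : ∀ v ∉ L, ∃ a b, a ≠ b ∧ T.Adj v a ∧ T.Adj v b) : G.IsGood := by
  classical
  have : Fintype V := Fintype.ofFinite V
  have hG : T ≤ G := fun _ _ h => (hTG h).1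
  have hne : L.Nonempty := by
    by_contra! hL0
    obtain ⟨v⟩ := hT.connected.nonempty
    obtain ⟨a, b, hab, hva, hvb⟩ := hdeg v (by simp [hL0])
    have : Nontrivial V := ⟨a, b, hab⟩
    obtain ⟨x, hx⟩ := hT.exists_vert_degree_one_of_nontrivial
    obtain ⟨y, hy, huniq⟩ := degree_eq_one_iff_existsUnique_adj.1 hx
    obtain ⟨a, b, hab, hxa, hxb⟩ := hdeg x (by simp [hL0])
    exact hab ((huniq a hxa).trans (huniq b hxb).symm)
  let O : G.Subgraph :=
    { verts := L
      Adj := fun u v => G.Adj u v ∧ u ∈ L ∧ v ∈ L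
      adj_sub := fun h => h.1
      edge_vert := fun h => h.2.1
      symm := ⟨fun _ _ h => ⟨h.1.symm, h.2.symm⟩⟩ }
  let M : G.Subgraph :=
    { verts := {u | ∃ v, G.Adj u v ∧ ¬ T.Adj u v ∧ ¬ (u ∈ L ∧ v ∈ L)}
      Adj := fun u v => G.Adj u v ∧ ¬ T.Adj u v ∧ ¬ (u ∈ L ∧ v ∈ L)
      adj_sub := fun h => h.1
      edge_vert := fun h => ⟨_, h⟩
      symm := ⟨fun _ _ h => ⟨h.1.symm, fun h' => h.2.1 h'.symm, fun h' => h.2.2 h'.symm⟩⟩ }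
  refine ⟨toSubgraph T hG, M, O, ?_, ?_, ?_, ?_, hne, ?_, ?_, ?_, ?_⟩
  · exact toSubgraph.isSpanning T hG
  · rw [← ((toSubgraph T hG).spanningCoeEquivCoeOfSpanning
      (toSubgraph.isSpanning T hG)).isTree_iff]
    exact hT
  · rintro v ⟨w, hw⟩
    refine ⟨w, hw, fun x (hx : G.Adj v x ∧ ¬ T.Adj v x ∧ ¬ (v ∈ L ∧ x ∈ L)) => ?_⟩
    by_cases hv : v ∈ L
    · obtain ⟨a, b, hab, hvx⟩ := hL v hv
      obtain ⟨hva, haL⟩ := (hvx a).2 (Or.inl rfl)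
      obtain ⟨hvb, hbL⟩ := (hvx b).2 (Or.inr rfl)
      obtain ⟨c, -, -, -, hall⟩ := h3 v a b hva hvb hab
      have h1 := hall w hw.1
      have h2 := hall x hx.1
      grind
    · obtain ⟨a, b, hab, hva, hvb⟩ := hdeg v hv
      obtain ⟨c, -, -, -, hall⟩ := h3 v a b (hG hva) (hG hvb) hab
      have h1 := hall w hw.1
      have h2 := hall x hx.1
      grind
  · intro v hv
    obtain ⟨a, b, hab, hvx⟩ := hL v hv
    have : O.neighborSet v = {a, b} := by
      ext x
      rw [Subgraph.mem_neighborSet, Set.mem_insert_iff, Set.mem_singleton_iff, ← hvx x]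
      exact ⟨fun h => ⟨h.1, h.2.2⟩, fun h => ⟨h.1, hv, h.2⟩⟩
    rw [this, Set.ncard_pair hab]
  · ext e
    induction e with | _ u v
    simp only [Set.mem_union, Subgraph.mem_edgeSet, mem_edgeSet]
    change (T.Adj u v ∨ (G.Adj u v ∧ ¬ T.Adj u v ∧ ¬ (u ∈ L ∧ v ∈ L))) ∨
      (G.Adj u v ∧ u ∈ L ∧ v ∈ L) ↔ G.Adj u v
    have := @hG u v
    tauto
  · rw [Set.disjoint_left]
    intro e
    induction e with | _ u v
    exact fun h h' => h'.2.1 h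
  · rw [Set.disjoint_left]
    intro e
    induction e with | _ u v
    exact fun h h' => (hTG h).2 h'.2
  · rw [Set.disjoint_left]
    intro e
    induction e with | _ u v
    exact fun h h' => h.2.2 h'.2

theorem IsGood.of_hasThirdNeighbors [Finite V] (hconn : G.Connected) (h3 : G.HasThirdNeighbors)
    (htri : ∀ v, ∃ a b, G.Adj v a ∧ G.Adj v b ∧ G.Adj a b) : G.IsGood := by
  have h0 : G.Removable ∅ := by
    refine ⟨by simp, ?_⟩
    have : G.withoutEdgesIn ∅ = G := by ext; simp [withoutEdgesIn]
    rwa [this]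
  obtain ⟨L, hL⟩ := exists_maximal_of_wellFoundedGT G.Removable ⟨∅, h0⟩
  -- Minimality makes every edge of `C` outside triangles a bridge; the triangle edges kept give
  -- degree two outside `L`.
  obtain ⟨C, hC⟩ := exists_minimal_of_wellFoundedLT
    (fun C : SimpleGraph V => C.Connected ∧ C ≤ G.withoutEdgesIn L ∧
      ∀ u v, (G.withoutEdgesIn L).Adj u v → G.InTriangle u v → C.Adj u v)
    ⟨_, hL.prop.connected, le_rfl, fun _ _ h _ => h⟩
  obtain ⟨hCconn, hCL, hCtri⟩ := hC.prop
  have hCdeg : ∀ v ∉ L, ∃ a b, a ≠ b ∧ C.Adj v a ∧ C.Adj v b := by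
    intro v hv
    obtain ⟨a, b, hva, hvb, hab⟩ := htri v
    exact ⟨a, b, hab.ne, hCtri v a ⟨hva, fun h => hv h.1⟩ ⟨hva, b, hvb, hab⟩,
      hCtri v b ⟨hvb, fun h => hv h.1⟩ ⟨hvb, a, hva, hab.symm⟩⟩
  -- By minimality, a cycle edge of `T` not in two triangles has an end of degree at most two.
  obtain ⟨T, hT⟩ := exists_minimal_of_wellFoundedLT
    (fun T : SimpleGraph V => T.Connected ∧ T ≤ C ∧
      (∀ u v, G.InTwoTriangles u v → u ∉ L → T.Adj u v) ∧
      ∀ v ∉ L, ∃ a b, a ≠ b ∧ T.Adj v a ∧ T.Adj v b)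
    ⟨C, hCconn, le_rfl, fun u v h hu => hCtri u v ⟨h.1, fun h => hu h.1⟩
      ⟨h.1, h.2.imp fun _ ⟨_, _, h, _⟩ => h⟩, hCdeg⟩
  obtain ⟨hTconn, hTC, hTdbl, hTdeg⟩ := hT.prop
  refine IsGood.of_isTree h3 hL.prop.twoRegular (hTC.trans hCL) ⟨hTconn, ?_⟩ hTdeg
  refine Removable.isAcyclic_of_maximal h3 hL hTconn (hTC.trans hCL) hTdbl ?_ ?_
  · intro u v huv hb
    by_contra hn
    have hCb : ¬ C.IsBridge s(u, v) := fun h => hb (h.anti hTC)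
    have := hC.le_of_le (y := C.deleteEdges {s(u, v)})
      ⟨hCconn.connected_delete_edge_of_not_isBridge hCb, (deleteEdges_le _).trans hCL, ?_⟩
      (deleteEdges_le _) (hTC huv)
    · simp at this
    · intro x y hxy ht
      rw [deleteEdges_adj]
      refine ⟨hCtri x y hxy ht, fun h => ?_⟩
      rcases Sym2.eq_iff.1 (Set.mem_singleton_iff.1 h) with ⟨rfl, rfl⟩ | ⟨rfl, rfl⟩
      · exact hn ht
      · exact hn ⟨ht.1.symm, ht.2.imp fun _ h => h.symm⟩
  · intro u v huv hb hnd
    by_contra! hno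
    have := hT.le_of_le (y := T.deleteEdges {s(u, v)})
      ⟨hTconn.connected_delete_edge_of_not_isBridge hb, (deleteEdges_le _).trans hTC, ?_, ?_⟩
      (deleteEdges_le _) huv
    · simp at this
    · intro x y hd hx
      rw [deleteEdges_adj]
      refine ⟨hTdbl x y hd hx, fun h => ?_⟩
      rcases Sym2.eq_iff.1 (Set.mem_singleton_iff.1 h) with ⟨rfl, rfl⟩ | ⟨rfl, rfl⟩
      · exact hnd hd
      · obtain ⟨h, a, b, hab, h1, h2⟩ := hd
        exact hnd ⟨h.symm, a, b, hab, h1.symm, h2.symm⟩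
    · intro x hx
      have aux : ∀ y a, T.Adj x a → a ≠ y → (T.deleteEdges {s(x, y)}).Adj x a := by
        intro y a hxa hay
        simp [deleteEdges_adj, hxa, hay, hxa.ne']
      have hthree : ∀ y, (∃ a b c, T.Adj x a ∧ T.Adj x b ∧ T.Adj x c ∧ a ≠ b ∧ a ≠ c ∧ b ≠ c) →
          ∃ a b, a ≠ b ∧ (T.deleteEdges {s(x, y)}).Adj x a ∧
            (T.deleteEdges {s(x, y)}).Adj x b := by
        rintro y ⟨a, b, c, ha, hb, hc, hab, hac, hbc⟩
        by_cases h1 : a = y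
        · exact ⟨b, c, hbc, aux y b hb (by grind), aux y c hc (by grind)⟩
        · by_cases h2 : b = y
          · exact ⟨a, c, hac, aux y a ha h1, aux y c hc (by grind)⟩
          · exact ⟨a, b, hab, aux y a ha h1, aux y b hb h2⟩
      by_cases hxu : x = u
      · subst hxu
        exact hthree v (hno x (Or.inl rfl))
      · by_cases hxv : x = v
        · subst hxv
          rw [Sym2.eq_swap]
          exact hthree u (hno x (Or.inr rfl))
        · obtain ⟨a, b, hab, ha, hb⟩ := hTdeg x hx
          refine ⟨a, b, hab, ?_, ?_⟩
          · simp [deleteEdges_adj, ha, hxu, hxv]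
          · simp [deleteEdges_adj, hb, hxu, hxv]

end SimpleGraph

theorem mainTheorem1 {V : Type*} [Fintype V] (G : SimpleGraph V) [DecidableRel G.Adj]
    (hconn : G.Connected) (hcubic : G.IsRegularOfDegree 3) (hclaw : G.ClawFree) :
    G.IsGood :=
  SimpleGraph.IsGood.of_hasThirdNeighbors hconn hcubic.hasThirdNeighbors
    fun v => hclaw.exists_triangle hcubic v
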